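/- **Theorem (Ultimate expansion).** Work in max-times algebra on $\mathbb R_+$: $a\oplus b=\max(a,b)$ and $a\otimes b=ab$; matrix products, powers $A^t$ (with $A^0=I$) and the Kleene star $A^*=I\oplus A\oplus A^2\oplus\cdots$ are taken in this algebra. *Notation.* Let $A=(a_{ij})\in\mathbb R_+^{n\times n}$. Its digraph $D(A)$ has nodes $N=\{1,\dots,n\}$ and edges $(i,j)$ with $a_{ij}\ne 0$. The weight $w(P)$ of a path $P$ is the product of the entries $a_{ij}$ along its edges. Let $\lambda(A)$ be the maximum of $w(P)^{1/k}$ over all cycles $P$ in $D(A)$ of length $k$, $1\le k\le n$ (and $\lambda(A)=0$ if there are none). A cycle $P$ of length $k$ is critical if $w(P)^{1/k}=\lambda(A)$; the critical digraph $\mathcal C(A)$ consists of the nodes and edges on critical cycles. The cyclicity of a strongly connected digraph is the g.c.d. of the lengths of its simple cycles; the cyclicity of $\mathcal C(A)$ is the l.c.m. of the cyclicities of its strongly connected components. For $K\subseteq N$, let $A[K]$ be the $n\times n$ matrix that agrees with $A$ on $K\times K$ and is $0$ elsewhere. *Canonical Nachtigall reduction.* Put $K_1=N$, $A_\mu=A[K_\mu]$,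 $\lambda_\mu=\lambda(A_\mu)$ and $K_{\mu+1}=K_\mu\setminus N_\mu$, where $N_\mu$ is the node set of $\mathcal C(A_\mu)$. Let $m$ be the last $\mu$ with $\lambda_\mu\neq 0$ (with $m=0$ if $\lambda_1=0$). *Ultimate reduction.* Put $K_1^\circ=N$, $A_\mu^\circ=A[K_\mu^\circ]$, $\lambda_\mu^\circ=\lambda(A_\mu^\circ)$ and $K^\circ_{\mu+1}=K^\circ_\mu\setminus M^\circ_\mu$, where $M^\circ_\mu$ is the set of all nodes in those strongly connected components of $D(A)$ that contain a node of $\mathcal C(A^\circ_\mu)$; stop when $\lambda^\circ_\mu=0$. The nonzero numbers $\lambda_\mu$ are strictly decreasing, so are the nonzero numbers $\lambda_\mu^\circ$, and every nonzero $\lambda^\circ_\nu$ equals exactly one of $\lambda_1,\dots,\lambda_m$. Let $\Sigma\subseteq\{1,\dots,m\}$ be the set of those $\mu$ for which $\lambda_\mu$ is one of the nonzero $\lambda^\circ_\nu$, and renumber the objects of the ultimate reduction by $\Sigma$ so that $\lambda^\circ_\mu=\lambda_\mu$ for all $\mu\in\Sigma$. *CSR terms.* For $\mu\in\Sigma$ let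 $\mathcal C_\mu^\circ=(N^\circ_\mu,E^\circ_\mu)=\mathcal C(A^\circ_\mu)$, let $\gamma^\circ_\mu$ be its cyclicity, and let $B^\circ_\mu=\bigl((A^\circ_\mu/\lambda_\mu)^{\gamma^\circ_\mu}\bigr)^*$. Let $C^\circ_\mu$ be obtained from $B^\circ_\mu$ by replacing all columns with index outside $N^\circ_\mu$ by zero, $R^\circ_\mu$ from $B^\circ_\mu$ by replacing all rows with index outside $N^\circ_\mu$ by zero, and $S^\circ_\mu$ from $A^\circ_\mu/\lambda_\mu$ by replacing all entries with position outside $E^\circ_\mu$ by zero. *Claim.* For every $A\in\mathbb R_+^{n\times n}$ all the Kleene stars $B^\circ_\mu$, $\mu\in\Sigma$, are finite, and for every $\mu\in\Sigma$ there is $T$ such that for all $t\ge T$ $$(A^\circ_\mu)^t=\bigoplus_{\nu\in\Sigma,\ \nu\ge\mu}\lambda_\nu^t\,C^\circ_\nu (S^\circ_\nu)^t R^\circ_\nu .$$ In particular, there is $T$ such that for all $t\ge T$ $$A^t=\bigoplus_{\nu\in\Sigma}\lambda_\nu^t\,C^\circ_\nu (S^\circ_\nu)^t R^\circ_\nu ,$$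 where an empty sum is the zero matrix. -/

import Mathlib

open scoped NNReal

namespace MaxAlg

/-! Max-times algebra: nonnegative reals, `a ⊕ b = max a b`, ordinary multiplication. -/

/-- Square nonnegative matrices of order `n`. -/
abbrev Mat (n : ℕ) := Matrix (Fin n) (Fin n) ℝ≥0

variable {n : ℕ}

/-- The max-times matrix product. -/
def mmul (A B : Mat n) : Mat n :=
  fun i j => Finset.univ.sup fun k => A i k * B k j

/-- The max-times matrix power, with `A ^ 0` the identity matrix. -/
def mpow (A : Mat n) : ℕ → Mat n
  | 0 => 1
  | t + 1 => mmul (mpow A t) A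

/-- The entries of the series `I ⊕ A ⊕ A² ⊕ ⋯` are finite. -/
def KleeneFinite (A : Mat n) : Prop :=
  ∀ i j, BddAbove (Set.range fun k : ℕ => mpow A k i j)

/-- The Kleene star `A* = I ⊕ A ⊕ A² ⊕ ⋯` (meaningful when `KleeneFinite A`). -/
noncomputable def kleene (A : Mat n) : Mat n :=
  fun i j => ⨆ k : ℕ, mpow A k i j

/-! Digraphs on `Fin n`, given by their edge relation. -/

/-- The nodes `p 0, …, p k` form a path with `k` edges. -/
def IsPath (E : Fin n → Fin n → Prop) {k : ℕ} (p : Fin (k + 1) → Fin n) : Prop :=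
  ∀ s : Fin k, E (p s.castSucc) (p s.succ)

/-- A cycle: a closed path with at least one edge (nodes may be repeated). -/
def IsCycle (E : Fin n → Fin n → Prop) {k : ℕ} (p : Fin (k + 1) → Fin n) : Prop :=
  0 < k ∧ IsPath E p ∧ p 0 = p (Fin.last k)

/-- A simple cycle: no node is repeated except that the last one is the first one. -/
def IsSimpleCycle (E : Fin n → Fin n → Prop) {k : ℕ} (p : Fin (k + 1) → Fin n) : Prop :=
  IsCycle E p ∧ Function.Injective fun s : Fin k => p s.castSucc

/-- `i` and `j` lie in the same strongly connected component. -/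
def SameComp (E : Fin n → Fin n → Prop) (i j : Fin n) : Prop :=
  Relation.ReflTransGen E i j ∧ Relation.ReflTransGen E j i

open Classical in
/-- The cyclicity of the strongly connected component of `i`: the g.c.d. of the lengths of its
simple cycles (such lengths are at most `n`). -/
noncomputable def compCyclicity (E : Fin n → Fin n → Prop) (i : Fin n) : ℕ :=
  ((Finset.Icc 1 n).filter fun k =>
    ∃ p : Fin (k + 1) → Fin n, IsSimpleCycle E p ∧ SameComp E i (p 0)).gcd id

open Classical in
/-- The cyclicity of a digraph with node set `N` and edge relation `E`: the l.c.m. of the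
cyclicities of its strongly connected components. -/
noncomputable def cyclicity (N : Fin n → Prop) (E : Fin n → Fin n → Prop) : ℕ :=
  (Finset.univ.filter N).lcm fun i => compCyclicity E i

/-! The digraph of a matrix, the maximum cycle geometric mean, the critical digraph. -/

/-- The edge relation of the digraph associated with `A`. -/
def Edge (A : Mat n) (i j : Fin n) : Prop := A i j ≠ 0

/-- The weight of a path: the product of the weights of its edges. -/
noncomputable def weight (A : Mat n) {k : ℕ} (p : Fin (k + 1) → Fin n) : ℝ≥0 :=
  ∏ s : Fin k, A (p s.castSucc) (p s.succ)

/-- The geometric mean of the edge weights of a path with `k` edges. -/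
noncomputable def geomMean (A : Mat n) {k : ℕ} (p : Fin (k + 1) → Fin n) : ℝ≥0 :=
  weight A p ^ (1 / (k : ℝ))

open Classical in
/-- The maximum cycle geometric mean, over all cycles of length `1, …, n`; it is `0` when there
are no cycles. -/
noncomputable def mcgm (A : Mat n) : ℝ≥0 :=
  (Finset.Icc 1 n).sup fun k =>
    (Finset.univ.filter fun p : Fin (k + 1) → Fin n => IsCycle (Edge A) p).sup fun p =>
      geomMean A p

/-- A critical cycle: its geometric mean is the maximum one. -/
def IsCritCycle (A : Mat n) {k : ℕ} (p : Fin (k + 1) → Fin n) : Prop :=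
  IsCycle (Edge A) p ∧ geomMean A p = mcgm A

/-- Critical nodes: those on a critical cycle. -/
def CritNode (A : Mat n) (i : Fin n) : Prop :=
  ∃ (k : ℕ) (p : Fin (k + 1) → Fin n), IsCritCycle A p ∧ ∃ s, p s = i

/-- Critical edges: those on a critical cycle. -/
def CritEdge (A : Mat n) (i j : Fin n) : Prop :=
  ∃ (k : ℕ) (p : Fin (k + 1) → Fin n), IsCritCycle A p ∧
    ∃ s : Fin k, p s.castSucc = i ∧ p s.succ = j

/-- The cyclicity of the critical digraph of `A`. -/
noncomputable def critCyclicity (A : Mat n) : ℕ := cyclicity (CritNode A) (CritEdge A)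

/-! The matrices `C`, `S`, `R` built from `A` and its critical digraph (used for `mcgm A ≠ 0`). -/

/-- The matrix `A / λ(A)`. -/
noncomputable def normalized (A : Mat n) : Mat n := fun i j => A i j / mcgm A

/-- The matrix `(A / λ(A)) ^ γ`, where `γ` is the cyclicity of the critical digraph. -/
noncomputable def normPow (A : Mat n) : Mat n := mpow (normalized A) (critCyclicity A)

open Classical in
/-- The critical columns of the Kleene star of `normPow A`. -/
noncomputable def matC (A : Mat n) : Mat n :=
  fun i j => if CritNode A j then kleene (normPow A) i j else 0

open Classical in
/-- The critical rows of the Kleene star of `normPow A`. -/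
noncomputable def matR (A : Mat n) : Mat n :=
  fun i j => if CritNode A i then kleene (normPow A) i j else 0

open Classical in
/-- The critical entries of `A / λ(A)`. -/
noncomputable def matS (A : Mat n) : Mat n :=
  fun i j => if CritEdge A i j then normalized A i j else 0

/-- The product `C ⊗ S ^ t ⊗ R`. -/
noncomputable def csr (A : Mat n) (t : ℕ) : Mat n :=
  mmul (mmul (matC A) (mpow (matS A) t)) (matR A)

open Classical in
/-- The matrix whose entries with both indices in `K` are those of `A`, the others being `0`. -/
noncomputable def restrict (A : Mat n) (K : Set (Fin n)) : Mat n :=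
  fun i j => if i ∈ K ∧ j ∈ K then A i j else 0

/-! The canonical Nachtigall reduction: at each step the nodes of the critical digraph of the
current matrix are removed. Steps are numbered from `0`; the process is considered only as long
as the maximum cycle geometric mean is nonzero (when it is `0`, the critical digraph is empty
and nothing changes any more). -/

/-- The node sets `K_μ`. -/
def nachtK (A : Mat n) : ℕ → Set (Fin n)
  | 0 => Set.univ
  | μ + 1 => nachtK A μ \ {i | CritNode (restrict A (nachtK A μ)) i}

/-- The numbers `λ_μ`. -/
noncomputable def nachtLam (A : Mat n) (μ : ℕ) : ℝ≥0 := mcgm (restrict A (nachtK A μ))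

/-! The ultimate reduction: at each step all the strongly connected components of the digraph of
`A` that meet the critical digraph of the current matrix are removed, same conventions. -/

/-- The node sets `K°`, in the order in which they are produced. -/
def ultK (A : Mat n) : ℕ → Set (Fin n)
  | 0 => Set.univ
  | k + 1 => ultK A k \ {i | ∃ j, CritNode (restrict A (ultK A k)) j ∧ SameComp (Edge A) i j}

/-- The numbers `λ°`, in the order in which they are produced. -/
noncomputable def ultLam (A : Mat n) (k : ℕ) : ℝ≥0 := mcgm (restrict A (ultK A k))

/-! Renumbering of the ultimate reduction along the canonical Nachtigall reduction. -/

open Classical in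
/-- The set `Σ` of all steps `μ` of the canonical Nachtigall reduction with `λ_μ ≠ 0` for which
`λ_μ` is one of the numbers `λ°`. Every step with `λ_μ ≠ 0` removes at least one of the `n` nodes,
hence there are at most `n` of them. -/
noncomputable def sigmaSet (A : Mat n) : Finset ℕ :=
  (Finset.range n).filter fun μ => nachtLam A μ ≠ 0 ∧ ∃ k, ultLam A k = nachtLam A μ

/-- For `μ ∈ Σ`, the (unique) step `k` of the ultimate reduction with `λ°_k = λ_μ`. -/
noncomputable def renum (A : Mat n) (μ : ℕ) : ℕ := sInf {k | ultLam A k = nachtLam A μ}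

/-- The reduced matrix `A°_μ`, in the new numbering. -/
noncomputable def ultMat (A : Mat n) (μ : ℕ) : Mat n := restrict A (ultK A (renum A μ))

end MaxAlg

/-!
Entries of max-times powers are maximal weights of walks. Let `M` be a matrix with maximum cycle
geometric mean `λ ≠ 0`, normalized to `λ = 1`, and let `γ` be the cyclicity of its critical
digraph. All cycles have weight at most `1`, so walks can be shortened by splitting off cycles;
in particular the Kleene star of `M ^ γ` is finite and attained by powers below `n`, and a walk can
be shortened to length below `γ n` in the same residue class modulo `γ`.

The engine is `eventually_one_le_mpow_matS`: at a critical node there are closed critical walks of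
every large length divisible by `γ`, and each of them has weight `1`. Inserting such walks gives
both comparisons with the CSR term: `C S ^ t R ≤ M ^ t` for large `t` (`eventually_csr_le`), and
every walk of length `t` through a critical node is dominated by `C S ^ t R` (`eventually_le_csr`).
A long walk that avoids the critical nodes has arbitrarily small weight, while `C S ^ t R` is
bounded below at all `(i, j)` joined by a walk of length `t` that meets the component of a critical
node; hence walks of the latter kind are dominated as well (`eventually_mpow_mul_mpow_le_csr`).

For the ultimate reduction, a walk in `A[K°ₖ]` either stays in `K°ₖ₊₁` or meets a strongly
connected component with a critical node of `A[K°ₖ]`, so the expansion follows by induction over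
the at most `n` steps (`eventually_mpow_restrict_ultK_eq`). The renumbering is harmless because
both sequences of means are strictly decreasing as long as they are nonzero, and every nonzero
`λ°ₖ` occurs in the Nachtigall reduction (`exists_nachtLam_eq_ultLam`).
-/

namespace MaxAlg

variable {n : ℕ}

open Filter

/-! ### Max-times products and powers -/

theorem mul_le_mmul (A B : Mat n) (i k j : Fin n) : A i k * B k j ≤ mmul A B i j :=
  Finset.le_sup (f := fun k => A i k * B k j) (Finset.mem_univ k)

theorem exists_mmul_eq (A B : Mat n) (i j : Fin n) : ∃ k, mmul A B i j = A i k * B k j := by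
  obtain ⟨k, -, hk⟩ := Finset.exists_mem_eq_sup Finset.univ ⟨i, Finset.mem_univ i⟩
    (fun k => A i k * B k j)
  exact ⟨k, hk⟩

theorem mmul_le_iff {A B : Mat n} {i j : Fin n} {c : ℝ≥0} :
    mmul A B i j ≤ c ↔ ∀ k, A i k * B k j ≤ c := by
  simp [mmul, Finset.sup_le_iff]

theorem mmul_assoc (A B C : Mat n) : mmul (mmul A B) C = mmul A (mmul B C) := by
  refine Matrix.ext fun i j => ?_
  apply le_antisymm
  · refine mmul_le_iff.2 fun k => ?_
    obtain ⟨l, hl⟩ := exists_mmul_eq A B i k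
    rw [hl, mul_assoc]
    exact (mul_le_mul_right (mul_le_mmul B C l k j) _).trans (mul_le_mmul A _ i l j)
  · refine mmul_le_iff.2 fun k => ?_
    obtain ⟨l, hl⟩ := exists_mmul_eq B C k j
    rw [hl, ← mul_assoc]
    exact (mul_le_mul_left (mul_le_mmul A B i k l) _).trans (mul_le_mmul _ C i l j)

theorem mmul_one (A : Mat n) : mmul A 1 = A := by
  refine Matrix.ext fun i j => ?_
  apply le_antisymm
  · refine mmul_le_iff.2 fun k => ?_
    rcases eq_or_ne k j with rfl | h
    · simp
    · simp [Matrix.one_apply_ne h]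
  · simpa using mul_le_mmul A 1 i j j

theorem one_mmul (A : Mat n) : mmul 1 A = A := by
  refine Matrix.ext fun i j => ?_
  apply le_antisymm
  · refine mmul_le_iff.2 fun k => ?_
    rcases eq_or_ne i k with rfl | h
    · simp
    · simp [Matrix.one_apply_ne h]
  · simpa using mul_le_mmul 1 A i i j

theorem mpow_zero_diag (A : Mat n) (x : Fin n) : mpow A 0 x x = 1 := Matrix.one_apply_eq x

theorem mpow_one (A : Mat n) : mpow A 1 = A := one_mmul A

theorem mpow_add (A : Mat n) (a b : ℕ) : mpow A (a + b) = mmul (mpow A a) (mpow A b) := by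
  induction b with
  | zero => exact (mmul_one _).symm
  | succ b ih =>
    change mmul (mpow A (a + b)) A = mmul _ (mmul (mpow A b) A)
    rw [ih, mmul_assoc]

theorem mpow_mul (A : Mat n) (a b : ℕ) : mpow A (a * b) = mpow (mpow A a) b := by
  induction b with
  | zero => rfl
  | succ b ih =>
    change mpow A (a * b + a) = mmul (mpow (mpow A a) b) (mpow A a)
    rw [mpow_add, ih]

theorem mpow_mul_mpow_le (A : Mat n) (a b : ℕ) (i k j : Fin n) :
    mpow A a i k * mpow A b k j ≤ mpow A (a + b) i j := by
  rw [mpow_add]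
  exact mul_le_mmul _ _ _ _ _

theorem exists_mpow_add_eq (A : Mat n) (a b : ℕ) (i j : Fin n) :
    ∃ k, mpow A (a + b) i j = mpow A a i k * mpow A b k j := by
  rw [mpow_add]
  exact exists_mmul_eq _ _ _ _

theorem mpow_mono {A B : Mat n} (h : ∀ i j, A i j ≤ B i j) (t : ℕ) (i j : Fin n) :
    mpow A t i j ≤ mpow B t i j := by
  induction t generalizing j with
  | zero => exact le_rfl
  | succ t ih =>
    refine mmul_le_iff.2 fun k => ?_
    exact (mul_le_mul' (ih k) (h k j)).trans (mul_le_mmul (mpow B t) B i k j)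

theorem mpow_div (A : Mat n) (c : ℝ≥0) (t : ℕ) (i j : Fin n) :
    mpow (fun i j => A i j / c) t i j = mpow A t i j / c ^ t := by
  induction t generalizing j with
  | zero => simp [mpow]
  | succ t ih =>
    apply le_antisymm
    · refine mmul_le_iff.2 fun k => ?_
      rw [ih, div_mul_div_comm, ← pow_succ]
      exact div_le_div_of_nonneg_right (mul_le_mmul (mpow A t) A i k j) zero_le
    · obtain ⟨k, hk⟩ := exists_mmul_eq (mpow A t) A i j
      change mmul (mpow A t) A i j / _ ≤ _
      rw [hk, pow_succ, ← div_mul_div_comm, ← ih]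
      exact mul_le_mmul _ (fun i j => A i j / c) i k j

/-! ### Powers and paths -/

theorem exists_path_of_mpow_ne_zero {A : Mat n} {t : ℕ} {i j : Fin n} (h : mpow A t i j ≠ 0) :
    ∃ p : ℕ → Fin n, p 0 = i ∧ p t = j ∧
      mpow A t i j = ∏ s ∈ Finset.range t, A (p s) (p (s + 1)) := by
  induction t generalizing j with
  | zero =>
    rcases eq_or_ne i j with rfl | hij
    · exact ⟨fun _ => i, rfl, rfl, by simp [mpow]⟩
    · exact absurd (Matrix.one_apply_ne hij) h
  | succ t ih =>
    obtain ⟨k, hk⟩ := exists_mmul_eq (mpow A t) A i j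
    change mpow A (t + 1) i j = _ at hk
    have h1 : mpow A t i k ≠ 0 := fun h0 => h (by rw [hk, h0, zero_mul])
    obtain ⟨p, hp0, hpt, hp⟩ := ih h1
    refine ⟨fun s => if s ≤ t then p s else j, by simpa using hp0, by simp, ?_⟩
    rw [hk, hp, Finset.prod_range_succ]
    congr 1
    · refine Finset.prod_congr rfl fun s hs => ?_
      have := Finset.mem_range.1 hs
      have h2 : s ≤ t ∧ s + 1 ≤ t := by omega
      simp [h2.1, h2.2]
    · simp [hpt]

theorem prod_le_mpow (A : Mat n) (p : ℕ → Fin n) (a k : ℕ) :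
    ∏ s ∈ Finset.Ico a (a + k), A (p s) (p (s + 1)) ≤ mpow A k (p a) (p (a + k)) := by
  induction k with
  | zero => simpa using (mpow_zero_diag A (p a)).ge
  | succ k ih =>
    rw [← add_assoc, Finset.prod_Ico_succ_top (by omega)]
    exact (mul_le_mul_left ih _).trans (mul_le_mmul (mpow A k) A _ _ _)

/-- A path with `n` or more edges revisits a node within its first `n` steps, so a cycle with at
most `n` edges can be split off. -/
theorem exists_cycle_split (A : Mat n) {t : ℕ} (ht : n ≤ t) (i j : Fin n) :
    ∃ (x : Fin n) (a d b : ℕ), a + d + b = t ∧ 1 ≤ d ∧ d ≤ n ∧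
      mpow A t i j ≤ mpow A a i x * mpow A d x x * mpow A b x j := by
  have hn : 0 < n := i.pos
  by_cases h : mpow A t i j = 0
  · exact ⟨i, 0, 1, t - 1, by omega, le_rfl, hn, by rw [h]; exact zero_le⟩
  obtain ⟨p, rfl, rfl, hp⟩ := exists_path_of_mpow_ne_zero h
  obtain ⟨u, v, huv, he⟩ := Fintype.exists_ne_map_eq_of_card_lt
    (fun s : Fin (n + 1) => p s) (by simp)
  wlog hlt : u < v generalizing u v
  · exact this v u huv.symm he.symm (lt_of_le_of_ne (not_lt.1 hlt) huv.symm)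
  obtain ⟨d, hd⟩ : ∃ d, (v : ℕ) = u + d := ⟨v - u, by omega⟩
  obtain ⟨b, hb⟩ : ∃ b, t = u + d + b := ⟨t - v, by omega⟩
  refine ⟨p u, u, d, b, hb.symm, by omega, by omega, ?_⟩
  have h1 := prod_le_mpow A p 0 u
  have h2 := prod_le_mpow A p u d
  have h3 := prod_le_mpow A p (u + d) b
  change p u = p v at he
  rw [← hd, ← he] at h2
  rw [← hb, ← hd, ← he] at h3
  rw [zero_add] at h1
  rw [hp, Finset.range_eq_Ico, ← Finset.prod_Ico_consecutive _ (Nat.zero_le (v : ℕ)) (by omega),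
    ← Finset.prod_Ico_consecutive _ (Nat.zero_le (u : ℕ)) (by omega : (u : ℕ) ≤ v)]
  exact mul_le_mul' (mul_le_mul' h1 h2) h3

theorem mpow_le_of_cycle_le {A : Mat n} {c : ℝ≥0}
    (hc : ∀ d, 1 ≤ d → d ≤ n → ∀ x, mpow A d x x ≤ c ^ d) {t : ℕ} (ht : n ≤ t) (i j : Fin n) :
    ∃ d, 1 ≤ d ∧ d ≤ n ∧ mpow A t i j ≤ c ^ d * mpow A (t - d) i j := by
  obtain ⟨x, a, d, b, rfl, hd1, hdn, h⟩ := exists_cycle_split A ht i j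
  refine ⟨d, hd1, hdn, h.trans ?_⟩
  rw [mul_right_comm, mul_comm, show a + d + b - d = a + b by omega]
  exact mul_le_mul' (hc d hd1 hdn x) (mpow_mul_mpow_le A a b i x j)

theorem mpow_diag_le {A : Mat n} {c : ℝ≥0}
    (hc : ∀ d, 1 ≤ d → d ≤ n → ∀ x, mpow A d x x ≤ c ^ d) (t : ℕ) (x : Fin n) :
    mpow A t x x ≤ c ^ t := by
  induction t using Nat.strong_induction_on with
  | _ t ih =>
    rcases Nat.eq_zero_or_pos t with rfl | h0
    · simp [mpow]
    rcases le_total t n with h | h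
    · exact hc t h0 h x
    obtain ⟨d, hd1, hdn, hd⟩ := mpow_le_of_cycle_le hc h x x
    refine hd.trans ((mul_le_mul_right (ih (t - d) (by omega)) _).trans ?_)
    rw [← pow_add, Nat.add_sub_cancel' (by omega)]

/-- If no cycle has weight above `1`, then a power is dominated entrywise by powers of order
below `n`. -/
theorem exists_mpow_le_lt {A : Mat n} (hc : ∀ t x, mpow A t x x ≤ 1) (t : ℕ) (i j : Fin n) :
    ∃ k < n, mpow A t i j ≤ mpow A k i j := by
  induction t using Nat.strong_induction_on with
  | _ t ih =>
    rcases lt_or_ge t n with h | h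
    · exact ⟨t, h, le_rfl⟩
    obtain ⟨d, hd1, hdn, hd⟩ := mpow_le_of_cycle_le (c := 1) (by simpa using fun d _ _ => hc d) h i j
    obtain ⟨k, hk, hk'⟩ := ih (t - d) (by omega)
    exact ⟨k, hk, (by simpa using hd : _ ≤ _).trans hk'⟩

/-! ### Cycles, powers and the maximum cycle geometric mean -/

theorem weight_eq_prod_range (A : Mat n) {k : ℕ} (p : ℕ → Fin n) :
    weight A (fun s : Fin (k + 1) => p s) = ∏ s ∈ Finset.range k, A (p s) (p (s + 1)) := by
  simp [weight, Finset.prod_range]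

theorem exists_nat_path {k : ℕ} (p : Fin (k + 1) → Fin n) :
    ∃ q : ℕ → Fin n, p = fun s : Fin (k + 1) => q s :=
  ⟨fun s => p (Fin.ofNat (k + 1) s), by ext s; simp⟩

theorem isPath_nat_iff {E : Fin n → Fin n → Prop} {k : ℕ} {p : ℕ → Fin n} :
    IsPath E (fun s : Fin (k + 1) => p s) ↔ ∀ s < k, E (p s) (p (s + 1)) :=
  ⟨fun h s hs => h ⟨s, hs⟩, fun h s => h s s.2⟩

theorem geomMean_pow (A : Mat n) {k : ℕ} (hk : 0 < k) (p : Fin (k + 1) → Fin n) :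
    geomMean A p ^ k = weight A p := by
  rw [geomMean, one_div]
  exact NNReal.rpow_inv_natCast_pow _ hk.ne'

theorem weight_ne_zero_of_isPath {A : Mat n} {k : ℕ} {p : Fin (k + 1) → Fin n}
    (h : IsPath (Edge A) p) : weight A p ≠ 0 :=
  Finset.prod_ne_zero_iff.2 fun s _ => h s

theorem weight_le_mpow (A : Mat n) {k : ℕ} (p : Fin (k + 1) → Fin n) :
    weight A p ≤ mpow A k (p 0) (p (Fin.last k)) := by
  obtain ⟨q, rfl⟩ := exists_nat_path p
  rw [weight_eq_prod_range, Finset.range_eq_Ico]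
  simpa using prod_le_mpow A q 0 k

/-- A nonzero diagonal entry of a power is the weight of a cycle. -/
theorem exists_cycle_of_mpow_ne_zero {A : Mat n} {k : ℕ} (hk : 0 < k) {x : Fin n}
    (h : mpow A k x x ≠ 0) :
    ∃ p : Fin (k + 1) → Fin n, IsCycle (Edge A) p ∧ p 0 = x ∧ weight A p = mpow A k x x := by
  obtain ⟨q, h0, hk', hq⟩ := exists_path_of_mpow_ne_zero h
  refine ⟨fun s => q s, ⟨hk, isPath_nat_iff.2 fun s hs => ?_, ?_⟩, by simpa using h0, ?_⟩
  · rw [hq, Finset.prod_ne_zero_iff] at h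
    exact h s (Finset.mem_range.2 hs)
  · simp [h0, hk']
  · rw [weight_eq_prod_range, hq]

theorem geomMean_le_mcgm {A : Mat n} {k : ℕ} (hkn : k ≤ n) {p : Fin (k + 1) → Fin n}
    (hp : IsCycle (Edge A) p) : geomMean A p ≤ mcgm A := by
  classical
  have h1 := Finset.le_sup (f := fun p : Fin (k + 1) → Fin n => geomMean A p)
    (s := Finset.univ.filter fun p => IsCycle (Edge A) p) (b := p) (by simpa using hp)
  have h2 := Finset.le_sup (s := Finset.Icc 1 n) (b := k)
    (f := fun k => (Finset.univ.filter fun p : Fin (k + 1) → Fin n => IsCycle (Edge A) p).sup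
      fun p => geomMean A p) (Finset.mem_Icc.2 ⟨hp.1, hkn⟩)
  refine h1.trans (le_trans (le_of_eq ?_) (h2.trans (le_of_eq ?_)))
  · rfl
  · unfold mcgm
    congr!

/-- The weight of a cycle, of any length `t`, is at most the `t`-th power of the maximum cycle
geometric mean. -/
theorem mpow_diag_le_mcgm (A : Mat n) (t : ℕ) (x : Fin n) : mpow A t x x ≤ mcgm A ^ t := by
  refine mpow_diag_le (fun d hd hdn x => ?_) t x
  by_cases h : mpow A d x x = 0
  · rw [h]; exact zero_le
  obtain ⟨p, hp, -, hw⟩ := exists_cycle_of_mpow_ne_zero hd h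
  rw [← hw, ← geomMean_pow A hd]
  gcongr
  exact geomMean_le_mcgm hdn hp

theorem exists_cycle_of_mcgm_ne_zero {A : Mat n} (h : mcgm A ≠ 0) :
    ∃ (x : Fin n) (k : ℕ), 0 < k ∧ k ≤ n ∧ mcgm A ^ k ≤ mpow A k x x := by
  classical
  have h0 : 0 < mcgm A := pos_iff_ne_zero.2 h
  have h1 := h0
  rw [mcgm, Finset.lt_sup_iff] at h1
  obtain ⟨k₀, hk₀, -⟩ := h1
  obtain ⟨k, hk, hk'⟩ := Finset.exists_mem_eq_sup (Finset.Icc 1 n) ⟨k₀, hk₀⟩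
    (fun k => (Finset.univ.filter fun p : Fin (k + 1) → Fin n => IsCycle (Edge A) p).sup
      fun p => geomMean A p)
  have hk2 : mcgm A = (Finset.univ.filter fun p : Fin (k + 1) → Fin n => IsCycle (Edge A) p).sup
      fun p => geomMean A p := by
    rw [← hk']
    unfold mcgm
    congr!
  have h2 := h0
  rw [hk2, Finset.lt_sup_iff] at h2
  obtain ⟨p₀, hp₀, -⟩ := h2
  obtain ⟨p, hp, hp'⟩ := Finset.exists_mem_eq_sup
    (Finset.univ.filter fun p : Fin (k + 1) → Fin n => IsCycle (Edge A) p) ⟨p₀, hp₀⟩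
      (fun p => geomMean A p)
  rw [hp'] at hk2
  have hc : IsCycle (Edge A) p := by simpa using hp
  have h3 := weight_le_mpow A p
  rw [← hc.2.2] at h3
  refine ⟨p 0, k, hc.1, (Finset.mem_Icc.1 hk).2, ?_⟩
  rw [hk2, geomMean_pow A hc.1]
  exact h3

theorem mcgm_mono {A B : Mat n} (h : ∀ i j, A i j ≤ B i j) : mcgm A ≤ mcgm B := by
  by_cases h0 : mcgm A = 0
  · rw [h0]; exact zero_le
  obtain ⟨x, k, hk, -, hx⟩ := exists_cycle_of_mcgm_ne_zero h0
  exact (pow_le_pow_iff_left₀ zero_le zero_le hk.ne').1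
    ((hx.trans (mpow_mono h k x x)).trans (mpow_diag_le_mcgm B k x))

/-! ### Strongly connected components -/

theorem reflTransGen_of_walk {E : Fin n → Fin n → Prop} {p : ℕ → Fin n} {k : ℕ}
    (h : ∀ s < k, E (p s) (p (s + 1))) {a b : ℕ} (hab : a ≤ b) (hb : b ≤ k) :
    Relation.ReflTransGen E (p a) (p b) := by
  induction b, hab using Nat.le_induction with
  | base => exact .refl
  | succ b hab ih => exact (ih (by omega)).tail (h b (by omega))

theorem SameComp.trans {E : Fin n → Fin n → Prop} {i j k : Fin n} (h : SameComp E i j)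
    (h' : SameComp E j k) : SameComp E i k :=
  ⟨h.1.trans h'.1, h'.2.trans h.2⟩

theorem SameComp.rfl {E : Fin n → Fin n → Prop} {i : Fin n} : SameComp E i i :=
  ⟨.refl, .refl⟩

/-! ### Critical nodes and edges -/

theorem mcgm_ne_zero_of_isCritCycle {A : Mat n} {k : ℕ} {p : Fin (k + 1) → Fin n}
    (h : IsCritCycle A p) : mcgm A ≠ 0 := by
  intro h0
  have h1 := geomMean_pow A h.1.1 p
  rw [h.2, h0, zero_pow h.1.1.ne'] at h1
  exact weight_ne_zero_of_isPath h.1.2.1 h1.symm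

/-- A critical cycle, cut open at position `s`: the two arcs have total weight `λ ^ k`. -/
theorem IsCritCycle.rotate {A : Mat n} {k : ℕ} {p : ℕ → Fin n}
    (h : IsCritCycle A (fun s : Fin (k + 1) => p s)) {s r : ℕ} (hs : s ≤ r) (hr : r ≤ k) :
    mcgm A ^ k ≤ (∏ i ∈ Finset.Ico s r, A (p i) (p (i + 1))) *
      mpow A (k - r + s) (p r) (p s) := by
  have h0 : p 0 = p k := by simpa using h.1.2.2
  rw [← h.2, geomMean_pow A h.1.1, weight_eq_prod_range, Finset.range_eq_Ico,
    ← Finset.prod_Ico_consecutive _ (Nat.zero_le r) hr,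
    ← Finset.prod_Ico_consecutive _ (Nat.zero_le s) hs, mul_comm (∏ i ∈ Finset.Ico 0 s, _),
    mul_assoc]
  refine mul_le_mul_right ?_ _
  have h1 := prod_le_mpow A p 0 s
  have h2 := prod_le_mpow A p r (k - r)
  rw [Nat.add_sub_cancel' hr] at h2
  rw [zero_add, h0] at h1
  rw [mul_comm]
  exact (mul_le_mul' h2 h1).trans (mpow_mul_mpow_le A _ _ _ _ _)

theorem CritNode.mcgm_ne_zero {A : Mat n} {x : Fin n} (h : CritNode A x) : mcgm A ≠ 0 := by
  obtain ⟨k, p, hp, -⟩ := h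
  exact mcgm_ne_zero_of_isCritCycle hp

theorem critNode_of_le {A : Mat n} (h : mcgm A ≠ 0) {x : Fin n} {k : ℕ} (hk : 0 < k)
    (hx : mcgm A ^ k ≤ mpow A k x x) : CritNode A x := by
  have h1 : mpow A k x x ≠ 0 := ne_of_gt ((pow_pos (pos_iff_ne_zero.2 h) k).trans_le hx)
  obtain ⟨p, hp, h0, hw⟩ := exists_cycle_of_mpow_ne_zero hk h1
  refine ⟨k, p, ⟨hp, ?_⟩, 0, h0⟩
  refine (pow_left_inj₀ zero_le zero_le hk.ne').1 ?_
  rw [geomMean_pow A hk, hw]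
  exact le_antisymm (mpow_diag_le_mcgm A k x) hx

theorem CritNode.exists_le {A : Mat n} {x : Fin n} (h : CritNode A x) :
    ∃ k, 0 < k ∧ mcgm A ^ k ≤ mpow A k x x := by
  obtain ⟨k, p, hp, s, rfl⟩ := h
  obtain ⟨q, rfl⟩ := exists_nat_path p
  have := hp.rotate (s := s) (r := s) le_rfl (by omega)
  rw [Nat.sub_add_cancel (by omega)] at this
  exact ⟨k, hp.1.1, by simpa using this⟩

theorem exists_critNode {A : Mat n} (h : mcgm A ≠ 0) : ∃ x, CritNode A x := by
  obtain ⟨x, k, hk, -, hx⟩ := exists_cycle_of_mcgm_ne_zero h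
  exact ⟨x, critNode_of_le h hk hx⟩

/-- A critical edge can be completed to a cycle whose mean is maximal. -/
theorem CritEdge.exists_le {A : Mat n} {u v : Fin n} (h : CritEdge A u v) :
    ∃ k, mcgm A ^ (k + 1) ≤ A u v * mpow A k v u := by
  obtain ⟨k, p, hp, s, rfl, rfl⟩ := h
  obtain ⟨q, rfl⟩ := exists_nat_path p
  have := hp.rotate (s := s) (r := s + 1) (by omega) (by omega)
  refine ⟨k - (s + 1) + s, ?_⟩
  rw [show k - (s + 1) + s + 1 = k by omega]
  simpa using this

theorem CritEdge.critNode_left {A : Mat n} {u v : Fin n} (h : CritEdge A u v) : CritNode A u := by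
  obtain ⟨k, p, hp, s, rfl, -⟩ := h
  exact ⟨k, p, hp, _, rfl⟩

theorem CritEdge.critNode_right {A : Mat n} {u v : Fin n} (h : CritEdge A u v) :
    CritNode A v := by
  obtain ⟨k, p, hp, s, -, rfl⟩ := h
  exact ⟨k, p, hp, _, rfl⟩

/-- Every critical node lies on a closed walk of critical edges. -/
theorem CritNode.exists_critEdge_walk {A : Mat n} {x : Fin n} (h : CritNode A x) :
    ∃ (k : ℕ) (p : ℕ → Fin n), 0 < k ∧ (∀ s < k, CritEdge A (p s) (p (s + 1))) ∧ p 0 = p k ∧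
      SameComp (CritEdge A) x (p 0) := by
  obtain ⟨k, p, hp, s, rfl⟩ := h
  obtain ⟨q, rfl⟩ := exists_nat_path p
  have he : ∀ s < k, CritEdge A (q s) (q (s + 1)) := fun s hs => ⟨k, _, hp, ⟨s, hs⟩, rfl, rfl⟩
  have h0 : q 0 = q k := by simpa using hp.1.2.2
  refine ⟨k, q, hp.1.1, he, h0, ?_, reflTransGen_of_walk he (Nat.zero_le _) (by omega)⟩
  rw [h0]
  exact reflTransGen_of_walk he (by omega) le_rfl

/-! ### The cyclicity is positive -/

/-- A shortest closed walk in a component is a simple cycle. -/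
theorem exists_isSimpleCycle {E : Fin n → Fin n → Prop} {i : Fin n} {k : ℕ} {p : ℕ → Fin n}
    (hk : 0 < k) (hp : ∀ s < k, E (p s) (p (s + 1))) (h0 : p 0 = p k) (hi : SameComp E i (p 0)) :
    ∃ (k : ℕ) (p : Fin (k + 1) → Fin n), 1 ≤ k ∧ k ≤ n ∧ IsSimpleCycle E p ∧
      SameComp E i (p 0) := by
  classical
  have hex : ∃ k, 0 < k ∧ ∃ p : ℕ → Fin n, (∀ s < k, E (p s) (p (s + 1))) ∧ p 0 = p k ∧
      SameComp E i (p 0) := ⟨k, hk, p, hp, h0, hi⟩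
  obtain ⟨hk, p, hp, h0, hi⟩ := Nat.find_spec hex
  have hmin := fun m => Nat.find_min hex (m := m)
  generalize Nat.find hex = k at *
  have hne : ∀ a b, a < b → b < k → p a ≠ p b := by
    intro a b hab hb he
    refine hmin (b - a) (by omega) ⟨by omega, fun s => p (a + s), fun s hs => ?_, ?_, ?_⟩
    · exact hp (a + s) (by omega)
    · simpa [Nat.add_sub_cancel' hab.le] using he
    · refine hi.trans ⟨?_, ?_⟩
      · exact reflTransGen_of_walk hp (Nat.zero_le _) (by omega)
      · rw [h0]
        exact reflTransGen_of_walk hp (by omega) le_rfl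
  have hinj : Function.Injective fun s : Fin k => p s := by
    intro a b hab
    rcases lt_trichotomy (a : ℕ) b with h | h | h
    · exact absurd hab (hne a b h b.2)
    · exact Fin.ext h
    · exact absurd hab.symm (hne b a h a.2)
  refine ⟨k, fun s => p s, hk, ?_, ⟨⟨hk, isPath_nat_iff.2 hp, by simpa using h0⟩, hinj⟩, hi⟩
  simpa using Fintype.card_le_of_injective _ hinj

theorem compCyclicity_ne_zero {E : Fin n → Fin n → Prop} {i : Fin n} {k : ℕ} {p : ℕ → Fin n}
    (hk : 0 < k) (hp : ∀ s < k, E (p s) (p (s + 1))) (h0 : p 0 = p k) (hi : SameComp E i (p 0)) :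
    compCyclicity E i ≠ 0 := by
  obtain ⟨k, p, hk1, hkn, hs, hc⟩ := exists_isSimpleCycle hk hp h0 hi
  intro h
  rw [compCyclicity, Finset.gcd_eq_zero_iff] at h
  have := h k (by simpa using ⟨⟨hk1, hkn⟩, p, hs, hc⟩)
  simp only [id] at this
  omega

theorem critCyclicity_pos (A : Mat n) : 0 < critCyclicity A := by
  refine Nat.pos_of_ne_zero fun h => ?_
  rw [critCyclicity, cyclicity, Finset.lcm_eq_zero_iff] at h
  obtain ⟨c, hc, h0⟩ := h
  obtain ⟨k, p, hk, hp, h1, h2⟩ := CritNode.exists_critEdge_walk (by simpa using hc)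
  exact compCyclicity_ne_zero hk hp h1 h2 h0

theorem compCyclicity_dvd_critCyclicity {A : Mat n} {c : Fin n} (hc : CritNode A c) :
    compCyclicity (CritEdge A) c ∣ critCyclicity A := by
  classical
  exact Finset.dvd_lcm (Finset.mem_filter.2 ⟨Finset.mem_univ c, hc⟩)

/-! ### Kleene stars -/

theorem exists_forall_mpow_le {P : Mat n} (hc : ∀ t x, mpow P t x x ≤ 1) (i j : Fin n) :
    ∃ k < n, ∀ t, mpow P t i j ≤ mpow P k i j := by
  obtain ⟨k, hk, hmax⟩ := Finset.exists_max_image (Finset.range n) (fun k => mpow P k i j)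
    ⟨0, Finset.mem_range.2 i.pos⟩
  refine ⟨k, Finset.mem_range.1 hk, fun t => ?_⟩
  obtain ⟨l, hl, h⟩ := exists_mpow_le_lt hc t i j
  exact h.trans (hmax l (Finset.mem_range.2 hl))

theorem kleeneFinite_of_diag_le {P : Mat n} (hc : ∀ t x, mpow P t x x ≤ 1) : KleeneFinite P := by
  intro i j
  obtain ⟨k, -, hk⟩ := exists_forall_mpow_le hc i j
  exact ⟨_, Set.forall_mem_range.2 hk⟩

theorem mpow_le_kleene {P : Mat n} (hc : ∀ t x, mpow P t x x ≤ 1) (t : ℕ) (i j : Fin n) :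
    mpow P t i j ≤ kleene P i j :=
  le_ciSup (kleeneFinite_of_diag_le hc i j) t

theorem exists_kleene_le {P : Mat n} (hc : ∀ t x, mpow P t x x ≤ 1) (i j : Fin n) :
    ∃ k < n, kleene P i j ≤ mpow P k i j := by
  obtain ⟨k, hkn, hk⟩ := exists_forall_mpow_le hc i j
  exact ⟨k, hkn, ciSup_le hk⟩

/-! ### The normalized matrix -/

theorem mpow_normalized (A : Mat n) (t : ℕ) (i j : Fin n) :
    mpow (normalized A) t i j = mpow A t i j / mcgm A ^ t :=
  mpow_div A _ t i j

theorem mpow_normalized_diag_le (A : Mat n) (t : ℕ) (x : Fin n) :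
    mpow (normalized A) t x x ≤ 1 := by
  rw [mpow_normalized]
  exact div_le_one_of_le₀ (mpow_diag_le_mcgm A t x) zero_le

theorem mpow_normPow (A : Mat n) (k : ℕ) (i j : Fin n) :
    mpow (normPow A) k i j = mpow (normalized A) (critCyclicity A * k) i j := by
  rw [mpow_mul]
  rfl

theorem mpow_normPow_diag_le (A : Mat n) (t : ℕ) (x : Fin n) : mpow (normPow A) t x x ≤ 1 := by
  rw [mpow_normPow]
  exact mpow_normalized_diag_le A _ x

theorem mpow_le_of_modEq {M : Mat n} (hc : ∀ t x, mpow M t x x ≤ 1) {g : ℕ} (hg : 0 < g) (t : ℕ)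
    (i j : Fin n) : ∃ r < g * n, r ≡ t [MOD g] ∧ mpow M t i j ≤ mpow M r i j := by
  obtain ⟨x, hx⟩ := exists_mpow_add_eq M (t % g) (g * (t / g)) i j
  rw [Nat.mod_add_div, mpow_mul] at hx
  obtain ⟨q, hq, h⟩ := exists_mpow_le_lt (A := mpow M g)
    (fun s x => by rw [← mpow_mul]; exact hc _ x) (t / g) x j
  refine ⟨t % g + g * q, ?_, ?_, ?_⟩
  · have h1 := Nat.mod_lt t hg
    have h2 : g * (q + 1) ≤ g * n := Nat.mul_le_mul_left _ hq
    rw [mul_add] at h2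
    omega
  · simp [Nat.ModEq]
  · rw [hx]
    refine (mul_le_mul_right h _).trans ?_
    rw [← mpow_mul]
    exact mpow_mul_mpow_le _ _ _ _ _ _

/-! ### Walks in the critical digraph -/

theorem matS_le_normalized (A : Mat n) (i j : Fin n) : matS A i j ≤ normalized A i j := by
  unfold matS
  split_ifs
  · exact le_rfl
  · exact zero_le

theorem critEdge_of_matS_ne_zero {A : Mat n} {i j : Fin n} (h : matS A i j ≠ 0) :
    CritEdge A i j := by
  by_contra h'
  exact h (if_neg h')

theorem matS_ne_zero {A : Mat n} {i j : Fin n} (h : CritEdge A i j) : matS A i j ≠ 0 := by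
  have h0 := h.critNode_left.mcgm_ne_zero
  obtain ⟨k, hk⟩ := h.exists_le
  have h1 : A i j ≠ 0 := by
    intro h1
    rw [h1, zero_mul] at hk
    exact pow_ne_zero _ h0 (le_zero_iff.1 hk)
  rw [matS, if_pos h]
  exact div_ne_zero h1 h0

/-- A walk in the critical digraph has a return walk in the digraph of `A` such that the closed
walk they form has normalized weight at least (hence equal to) `1`. -/
theorem exists_return_walk {A : Mat n} {t : ℕ} {u v : Fin n} (h : mpow (matS A) t u v ≠ 0) :
    ∃ k, 1 ≤ mpow (matS A) t u v * mpow (normalized A) k v u := by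
  induction t generalizing v with
  | zero =>
    rcases eq_or_ne u v with rfl | huv
    · exact ⟨0, by simp [mpow_zero_diag]⟩
    · exact absurd (Matrix.one_apply_ne huv) h
  | succ t ih =>
    obtain ⟨x, hx⟩ := exists_mmul_eq (mpow (matS A) t) (matS A) u v
    change mpow (matS A) (t + 1) u v = _ at hx
    rw [hx] at h ⊢
    obtain ⟨k, hk⟩ := ih (left_ne_zero_of_mul h)
    have he := critEdge_of_matS_ne_zero (right_ne_zero_of_mul h)
    obtain ⟨l, hl⟩ := he.exists_le
    have h0 : 0 < mcgm A := pos_iff_ne_zero.2 he.critNode_left.mcgm_ne_zero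
    have h1 : 1 ≤ matS A x v * mpow (normalized A) l v x := by
      rw [matS, if_pos he, mpow_normalized, normalized, div_mul_div_comm, ← pow_succ',
        one_le_div (pow_pos h0 _)]
      exact hl
    refine ⟨l + k, ?_⟩
    calc (1 : ℝ≥0) ≤ (mpow (matS A) t u x * mpow (normalized A) k x u) *
          (matS A x v * mpow (normalized A) l v x) := one_le_mul hk h1
      _ = mpow (matS A) t u x * matS A x v *
          (mpow (normalized A) l v x * mpow (normalized A) k x u) := by ring
      _ ≤ _ := mul_le_mul_right (mpow_mul_mpow_le _ _ _ _ _ _) _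

theorem one_le_mpow_matS_diag {A : Mat n} {t : ℕ} {x : Fin n} (h : mpow (matS A) t x x ≠ 0) :
    1 ≤ mpow (matS A) t x x := by
  obtain ⟨k, hk⟩ := exists_return_walk h
  exact hk.trans (mul_le_of_le_one_right' (mpow_normalized_diag_le A k x))

theorem mpow_add_ne_zero {A : Mat n} {a b : ℕ} {i k j : Fin n} (h : mpow A a i k ≠ 0)
    (h' : mpow A b k j ≠ 0) : mpow A (a + b) i j ≠ 0 := by
  have := (pos_iff_ne_zero.2 (mul_ne_zero h h')).trans_le (mpow_mul_mpow_le A a b i k j)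
  exact this.ne'

theorem exists_mpow_ne_zero {A : Mat n} {i j : Fin n}
    (h : Relation.ReflTransGen (Edge A) i j) : ∃ t, mpow A t i j ≠ 0 := by
  induction h with
  | refl => exact ⟨0, by simp [mpow_zero_diag]⟩
  | tail _ h ih =>
    obtain ⟨t, ht⟩ := ih
    exact ⟨t + 1, mpow_add_ne_zero ht (by rw [mpow_one]; exact h)⟩

/-- The lengths of the closed walks through a critical node in the critical digraph form a
numerical semigroup whose g.c.d. divides the cyclicity of the component, so it contains all large
multiples of the cyclicity. -/
theorem eventually_one_le_mpow_matS (A : Mat n) :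
    ∀ᶠ t in atTop, ∀ c, CritNode A c → critCyclicity A ∣ t → 1 ≤ mpow (matS A) t c c := by
  refine eventually_all.2 fun c => ?_
  by_cases hc : CritNode A c
  swap
  · exact Eventually.of_forall fun _ h => absurd h hc
  let Λ : AddSubmonoid ℕ :=
    { carrier := {t | mpow (matS A) t c c ≠ 0}
      zero_mem' := by simp [mpow_zero_diag]
      add_mem' := fun h h' => mpow_add_ne_zero h h' }
  have hmono : ∀ i j, CritEdge A i j → Edge (matS A) i j := fun i j h => matS_ne_zero h
  have hdvd : Nat.setGcd (Λ : Set ℕ) ∣ compCyclicity (CritEdge A) c := by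
    classical
    refine Finset.dvd_gcd fun k hk => ?_
    obtain ⟨-, p, hp, h1, h2⟩ := (Finset.mem_filter.1 hk)
    obtain ⟨a, ha⟩ := exists_mpow_ne_zero (Relation.ReflTransGen.mono hmono _ _ h1)
    obtain ⟨b, hb⟩ := exists_mpow_ne_zero (Relation.ReflTransGen.mono hmono _ _ h2)
    have hk : mpow (matS A) k (p 0) (p 0) ≠ 0 := by
      have h3 := weight_le_mpow (matS A) p
      rw [← hp.1.2.2] at h3
      exact ((pos_iff_ne_zero.2 (weight_ne_zero_of_isPath
        fun s => hmono _ _ (hp.1.2.1 s))).trans_le h3).ne'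
    have h4 : Nat.setGcd (Λ : Set ℕ) ∣ a + b := Nat.setGcd_dvd_of_mem (mpow_add_ne_zero ha hb)
    have h5 : Nat.setGcd (Λ : Set ℕ) ∣ a + k + b :=
      Nat.setGcd_dvd_of_mem (mpow_add_ne_zero (mpow_add_ne_zero ha hk) hb)
    rw [add_right_comm] at h5
    exact (Nat.dvd_add_right h4).1 h5
  obtain ⟨T, hT⟩ := Nat.exists_mem_closure_of_ge (Λ : Set ℕ)
  filter_upwards [eventually_ge_atTop T] with t ht _ hg
  have := hT t ht ((hdvd.trans (compCyclicity_dvd_critCyclicity hc)).trans hg)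
  rw [AddSubmonoid.closure_eq] at this
  exact one_le_mpow_matS_diag this

/-! ### CSR terms -/

theorem matC_of_critNode {A : Mat n} {i j : Fin n} (h : CritNode A j) :
    matC A i j = kleene (normPow A) i j := if_pos h

theorem matR_of_critNode {A : Mat n} {i j : Fin n} (h : CritNode A i) :
    matR A i j = kleene (normPow A) i j := if_pos h

theorem exists_csr_eq (A : Mat n) (t : ℕ) (i j : Fin n) :
    ∃ k l, csr A t i j = matC A i k * mpow (matS A) t k l * matR A l j := by
  obtain ⟨l, hl⟩ := exists_mmul_eq (mmul (matC A) (mpow (matS A) t)) (matR A) i j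
  obtain ⟨k, hk⟩ := exists_mmul_eq (matC A) (mpow (matS A) t) i l
  exact ⟨k, l, by rw [csr, hl, hk]⟩

theorem le_csr (A : Mat n) (t : ℕ) (i k l j : Fin n) :
    matC A i k * mpow (matS A) t k l * matR A l j ≤ csr A t i j :=
  (mul_le_mul_left (mul_le_mmul _ _ _ _ _) _).trans (mul_le_mmul _ (matR A) _ _ _)

/-- The middle factor of a CSR term can be shortened by any multiple of the cyclicity, which makes
room for the two outer factors. -/
theorem eventually_csr_le (A : Mat n) :
    ∀ᶠ t in atTop, ∀ i j, csr A t i j ≤ mpow (normalized A) t i j := by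
  obtain ⟨T, hT⟩ := eventually_atTop.1 (eventually_one_le_mpow_matS A)
  have hγ := critCyclicity_pos A
  filter_upwards [eventually_ge_atTop (T + 3 * (critCyclicity A * n))] with t ht i j
  obtain ⟨k, l, h⟩ := exists_csr_eq A t i j
  rw [h]
  by_cases hk : CritNode A k
  swap
  · rw [matC, if_neg hk, zero_mul, zero_mul]; exact zero_le
  by_cases hl : CritNode A l
  swap
  · rw [matR, if_neg hl, mul_zero]; exact zero_le
  obtain ⟨a, han, ha⟩ := exists_kleene_le (mpow_normPow_diag_le A) i k
  obtain ⟨b, hbn, hb⟩ := exists_kleene_le (mpow_normPow_diag_le A) l j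
  obtain ⟨r, hrn, hrt, hr⟩ := mpow_le_of_modEq (mpow_normalized_diag_le A) hγ t k l
  rw [mpow_normPow] at ha hb
  rw [matC_of_critNode hk, matR_of_critNode hl]
  generalize critCyclicity A = γ at *
  have ha' : γ * a ≤ γ * n := Nat.mul_le_mul_left _ han.le
  have hb' : γ * b ≤ γ * n := Nat.mul_le_mul_left _ hbn.le
  obtain ⟨L, hL⟩ : ∃ L, t = γ * a + (r + L) + γ * b :=
    ⟨t - r - γ * a - γ * b, by omega⟩
  have hdvd : γ ∣ L := by
    have h1 : γ ∣ t - r := (Nat.modEq_iff_dvd' (by omega)).1 hrt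
    rw [show t - r = γ * (a + b) + L by rw [hL, mul_add]; omega] at h1
    exact (Nat.dvd_add_right (dvd_mul_right _ _)).1 h1
  have hone : 1 ≤ mpow (normalized A) L l l :=
    (hT L (by omega) l hl hdvd).trans (mpow_mono (matS_le_normalized A) L l l)
  have hmid : mpow (matS A) t k l ≤ mpow (normalized A) (r + L) k l :=
    (mpow_mono (matS_le_normalized A) t k l).trans (hr.trans
      ((le_mul_of_one_le_right' hone).trans (mpow_mul_mpow_le _ _ _ _ _ _)))
  calc _ ≤ mpow (normalized A) (γ * a) i k * mpow (normalized A) (r + L) k l *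
        mpow (normalized A) (γ * b) l j := mul_le_mul' (mul_le_mul' ha hmid) hb
    _ ≤ mpow (normalized A) (γ * a + (r + L)) i l * mpow (normalized A) (γ * b) l j :=
        mul_le_mul_left (mpow_mul_mpow_le _ _ _ _ _ _) _
    _ ≤ _ := by
        rw [hL]
        exact mpow_mul_mpow_le _ _ _ _ _ _

theorem mpow_le_kleene_normPow (A : Mat n) {t : ℕ} (h : critCyclicity A ∣ t) (i j : Fin n) :
    mpow (normalized A) t i j ≤ kleene (normPow A) i j := by
  obtain ⟨k, rfl⟩ := h
  rw [← mpow_normPow]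
  exact mpow_le_kleene (mpow_normPow_diag_le A) k i j

/-- A walk through a critical node `c` is dominated by the CSR term of every large order
congruent to its length: a long closed critical walk is inserted at `c` and cut into three pieces,
the outer ones completing the two halves of the walk to lengths divisible by the cyclicity. -/
theorem eventually_le_csr (A : Mat n) :
    ∀ᶠ t in atTop, ∀ c, CritNode A c → ∀ a b, a + b ≡ t [MOD critCyclicity A] → ∀ i j,
      mpow (normalized A) a i c * mpow (normalized A) b c j ≤ csr A t i j := by
  obtain ⟨T, hT⟩ := eventually_atTop.1 (eventually_one_le_mpow_matS A)
  have hγ := critCyclicity_pos A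
  filter_upwards [eventually_ge_atTop T, eventually_ge_atTop 1] with t ht ht1 c hc a b hab i j
  have ha : a ≤ critCyclicity A * a := Nat.le_mul_of_pos_left a hγ
  have hb : b ≤ critCyclicity A * b := Nat.le_mul_of_pos_left b hγ
  obtain ⟨r, hr⟩ : ∃ r, critCyclicity A * a = a + r := ⟨_, (Nat.add_sub_cancel' ha).symm⟩
  obtain ⟨s, hs⟩ : ∃ s, critCyclicity A * b = s + b := ⟨_, (Nat.sub_add_cancel hb).symm⟩
  have hdvd : critCyclicity A ∣ r + t + s := by
    have h1 : a + b + (r + t + s) ≡ a + b + 0 [MOD critCyclicity A] := by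
      have h2 : a + b + (r + t + s) = critCyclicity A * (a + b) + t := by
        rw [mul_add, hr, hs]; ring
      rw [h2]
      refine Nat.ModEq.trans ?_ hab.symm
      simp [Nat.ModEq]
    exact (Nat.modEq_zero_iff_dvd).1 (Nat.ModEq.add_left_cancel' _ h1)
  have hone := hT (r + t + s) (by omega) c hc hdvd
  obtain ⟨e, he⟩ := exists_mpow_add_eq (matS A) (r + t) s c c
  obtain ⟨d, hd⟩ := exists_mpow_add_eq (matS A) r t c e
  rw [he, hd] at hone
  have hne : mpow (matS A) t d e ≠ 0 := by
    intro h0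
    rw [h0] at hone
    simp at hone
  have hdc : CritNode A d := by
    obtain ⟨x, hx⟩ := exists_mpow_add_eq (matS A) 1 (t - 1) d e
    rw [Nat.add_sub_cancel' ht1, mpow_one] at hx
    rw [hx] at hne
    exact (critEdge_of_matS_ne_zero (left_ne_zero_of_mul hne)).critNode_left
  have hec : CritNode A e := by
    obtain ⟨x, hx⟩ := exists_mpow_add_eq (matS A) (t - 1) 1 d e
    rw [Nat.sub_add_cancel ht1, mpow_one] at hx
    rw [hx] at hne
    exact (critEdge_of_matS_ne_zero (right_ne_zero_of_mul hne)).critNode_right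
  have h1 : mpow (normalized A) a i c * mpow (matS A) r c d ≤ matC A i d := by
    rw [matC_of_critNode hdc]
    refine le_trans ?_ (mpow_le_kleene_normPow A (dvd_mul_right _ a) i d)
    rw [hr]
    exact (mul_le_mul_right (mpow_mono (matS_le_normalized A) _ _ _) _).trans
      (mpow_mul_mpow_le _ _ _ _ _ _)
  have h2 : mpow (matS A) s e c * mpow (normalized A) b c j ≤ matR A e j := by
    rw [matR_of_critNode hec]
    refine le_trans ?_ (mpow_le_kleene_normPow A (dvd_mul_right _ b) e j)
    rw [hs]
    exact (mul_le_mul_left (mpow_mono (matS_le_normalized A) _ _ _) _).trans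
      (mpow_mul_mpow_le _ _ _ _ _ _)
  calc _ ≤ mpow (normalized A) a i c * mpow (normalized A) b c j *
        (mpow (matS A) r c d * mpow (matS A) t d e * mpow (matS A) s e c) :=
        le_mul_of_one_le_right' hone
    _ = mpow (normalized A) a i c * mpow (matS A) r c d * mpow (matS A) t d e *
        (mpow (matS A) s e c * mpow (normalized A) b c j) := by ring
    _ ≤ matC A i d * mpow (matS A) t d e * matR A e j :=
        mul_le_mul' (mul_le_mul_left h1 _) h2
    _ ≤ _ := le_csr A t i d e j

/-! ### Walks that avoid the critical nodes -/

theorem restrict_le (A : Mat n) (K : Set (Fin n)) (i j : Fin n) : restrict A K i j ≤ A i j := by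
  unfold restrict
  split_ifs
  · exact le_rfl
  · exact zero_le

theorem mpow_restrict_le (A : Mat n) (K : Set (Fin n)) (t : ℕ) (i j : Fin n) :
    mpow (restrict A K) t i j ≤ mpow A t i j :=
  mpow_mono (restrict_le A K) t i j

/-- Either an optimal walk stays inside `K`, or it passes through a node outside `K`. -/
theorem mpow_le_restrict_or (A : Mat n) (K : Set (Fin n)) (t : ℕ) (i j : Fin n) :
    mpow A t i j ≤ mpow (restrict A K) t i j ∨
      ∃ x ∉ K, ∃ a b, a + b = t ∧ mpow A t i j ≤ mpow A a i x * mpow A b x j := by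
  by_cases h : mpow A t i j = 0
  · left; rw [h]; exact zero_le
  obtain ⟨p, rfl, rfl, hp⟩ := exists_path_of_mpow_ne_zero h
  by_cases hK : ∀ s ≤ t, p s ∈ K
  · left
    have h1 := prod_le_mpow (restrict A K) p 0 t
    rw [zero_add] at h1
    refine le_trans (le_of_eq ?_) h1
    rw [hp, Finset.range_eq_Ico]
    refine Finset.prod_congr rfl fun s hs => ?_
    have hs' := (Finset.mem_Ico.1 hs).2
    exact (if_pos ⟨hK s hs'.le, hK (s + 1) hs'⟩).symm
  · right
    push Not at hK
    obtain ⟨s, hs, hsK⟩ := hK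
    refine ⟨p s, hsK, s, t - s, by omega, ?_⟩
    have h1 := prod_le_mpow A p 0 s
    have h2 := prod_le_mpow A p s (t - s)
    rw [zero_add] at h1
    rw [Nat.add_sub_cancel' hs] at h2
    rw [hp, Finset.range_eq_Ico, ← Finset.prod_Ico_consecutive _ (Nat.zero_le s) hs]
    exact mul_le_mul' h1 h2

theorem mem_of_mpow_restrict_ne_zero {A : Mat n} {K : Set (Fin n)} {t : ℕ} (ht : 0 < t)
    {i j : Fin n} (h : mpow (restrict A K) t i j ≠ 0) : i ∈ K ∧ j ∈ K := by
  have hne : ∀ u v, restrict A K u v ≠ 0 → u ∈ K ∧ v ∈ K := fun u v h => by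
    by_contra h'
    exact h (if_neg h')
  constructor
  · obtain ⟨x, hx⟩ := exists_mpow_add_eq (restrict A K) 1 (t - 1) i j
    rw [Nat.add_sub_cancel' ht, mpow_one] at hx
    rw [hx] at h
    exact (hne _ _ (left_ne_zero_of_mul h)).1
  · obtain ⟨x, hx⟩ := exists_mpow_add_eq (restrict A K) (t - 1) 1 i j
    rw [Nat.sub_add_cancel ht, mpow_one] at hx
    rw [hx] at h
    exact (hne _ _ (right_ne_zero_of_mul h)).2

/-- If all cycles have weight below `1`, then the powers tend to zero. -/
theorem eventually_mpow_le {D : Mat n} (hD : ∀ d, 0 < d → ∀ x, mpow D d x x < 1) {ε : ℝ≥0}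
    (hε : 0 < ε) : ∀ᶠ t in atTop, ∀ i j, mpow D t i j ≤ ε := by
  have hle : ∀ t x, mpow D t x x ≤ 1 := fun t x => by
    rcases Nat.eq_zero_or_pos t with rfl | h
    · exact (mpow_zero_diag D x).le
    · exact (hD t h x).le
  set θ : ℝ≥0 := (Finset.Icc 1 n ×ˢ Finset.univ).sup fun q : ℕ × Fin n => mpow D q.1 q.2 q.2
    with hθ
  have hθ1 : θ < 1 := by
    rw [hθ, Finset.sup_lt_iff (by exact zero_lt_one)]
    intro q hq
    exact hD _ (Finset.mem_Icc.1 (Finset.mem_product.1 hq).1).1 _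
  obtain ⟨C, hC⟩ : ∃ C : ℝ≥0, ∀ t i j, mpow D t i j ≤ C := by
    choose k _ hk using exists_forall_mpow_le hle
    refine ⟨Finset.univ.sup fun q : Fin n × Fin n => mpow D (k q.1 q.2) q.1 q.2, fun t i j => ?_⟩
    exact (hk i j t).trans (Finset.le_sup
      (f := fun q : Fin n × Fin n => mpow D (k q.1 q.2) q.1 q.2) (Finset.mem_univ (i, j)))
  have hm : ∀ m, ∃ T, ∀ t ≥ T, ∀ i j, mpow D t i j ≤ θ ^ m * C := by
    intro m
    induction m with
    | zero => exact ⟨0, fun t _ i j => by simpa using hC t i j⟩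
    | succ m ih =>
      obtain ⟨T, hT⟩ := ih
      refine ⟨T + n, fun t ht i j => ?_⟩
      obtain ⟨x, a, d, b, rfl, hd1, hdn, h⟩ := exists_cycle_split D (t := t) (by omega) i j
      have h1 : mpow D d x x ≤ θ := Finset.le_sup
        (f := fun q : ℕ × Fin n => mpow D q.1 q.2 q.2) (b := (d, x)) (by simp [hd1, hdn])
      calc _ ≤ mpow D a i x * mpow D d x x * mpow D b x j := h
        _ = mpow D d x x * (mpow D a i x * mpow D b x j) := by ring
        _ ≤ θ * (θ ^ m * C) := mul_le_mul' h1
          ((mpow_mul_mpow_le D a b i x j).trans (hT _ (by omega) i j))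
        _ = _ := by ring
  obtain ⟨m, hm'⟩ := NNReal.exists_pow_lt_of_lt_one (a := ε / (C + 1))
    (div_pos hε (by positivity)) hθ1
  obtain ⟨T, hT⟩ := hm m
  filter_upwards [eventually_ge_atTop T] with t ht i j
  refine (hT t ht i j).trans ?_
  calc θ ^ m * C ≤ ε / (C + 1) * (C + 1) := mul_le_mul' hm'.le (by simp)
    _ = ε := div_mul_cancel₀ _ (by positivity)

theorem exists_pos_le_mpow (M : Mat n) (N : ℕ) :
    ∃ δ : ℝ≥0, 0 < δ ∧ ∀ t < N, ∀ i j, mpow M t i j ≠ 0 → δ ≤ mpow M t i j := by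
  have h : ∀ᶠ δ : ℝ≥0 in nhdsWithin 0 (Set.Ioi 0), ∀ (t : Fin N) (i j : Fin n),
      mpow M t i j ≠ 0 → δ ≤ mpow M t i j := by
    refine eventually_all.2 fun t => eventually_all.2 fun i => eventually_all.2 fun j => ?_
    by_cases h0 : mpow M t i j = 0
    · exact Eventually.of_forall fun _ h => absurd h0 h
    · filter_upwards [mem_nhdsWithin_of_mem_nhds (Iic_mem_nhds (pos_iff_ne_zero.2 h0))] with δ h _
      exact h
  obtain ⟨δ, hδ, h0⟩ := (h.and self_mem_nhdsWithin).exists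
  exact ⟨δ, h0, fun t ht i j => hδ ⟨t, ht⟩ i j⟩

theorem mpow_mul_diag_ne_zero {A : Mat n} {t : ℕ} {x : Fin n} (h : mpow A t x x ≠ 0) (m : ℕ) :
    mpow A (t * m) x x ≠ 0 := by
  induction m with
  | zero => simp [mpow_zero_diag]
  | succ m ih => exact mpow_add_ne_zero ih h

/-- A uniform lower bound for the CSR term at those `(i, j)` that are joined by a walk meeting
the component of a critical node. The walk may avoid the critical nodes, so a detour of length
divisible by the cyclicity is added. -/
theorem exists_pos_le_csr (A : Mat n) :
    ∃ δ : ℝ≥0, 0 < δ ∧ ∀ᶠ t in atTop, ∀ c, CritNode A c → ∀ x, SameComp (Edge A) x c →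
      ∀ a b, a + b = t → ∀ i j, mpow A a i x ≠ 0 → mpow A b x j ≠ 0 → δ ≤ csr A t i j := by
  have hγ := critCyclicity_pos A
  obtain ⟨δ, hδ, hδ'⟩ := exists_pos_le_mpow (normalized A) (critCyclicity A * n)
  refine ⟨δ * δ * (δ * δ), by positivity, ?_⟩
  filter_upwards [eventually_le_csr A] with t ht c hc x hx a b hab i j ha hb
  obtain ⟨p, hp⟩ := exists_mpow_ne_zero hx.1
  obtain ⟨q, hq⟩ := exists_mpow_ne_zero hx.2
  -- the way back to `x` is prolonged so that the detour has length divisible by the cyclicity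
  have hq' : mpow A (q + (p + q) * (critCyclicity A - 1)) c x ≠ 0 :=
    mpow_add_ne_zero hq (mpow_mul_diag_ne_zero (mpow_add_ne_zero hp hq) _)
  have key : ∀ l u v, mpow A l u v ≠ 0 → ∃ r, r ≡ l [MOD critCyclicity A] ∧
      δ ≤ mpow (normalized A) r u v := by
    intro l u v h
    obtain ⟨r, hr, hrl, hle⟩ := mpow_le_of_modEq (mpow_normalized_diag_le A) hγ l u v
    refine ⟨r, hrl, hδ' r hr u v fun h0 => ?_⟩
    rw [h0, mpow_normalized] at hle
    exact div_ne_zero h (pow_ne_zero _ hc.mcgm_ne_zero) (le_zero_iff.1 hle)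
  obtain ⟨a', ha1, ha2⟩ := key _ _ _ ha
  obtain ⟨b', hb1, hb2⟩ := key _ _ _ hb
  obtain ⟨p', hp1, hp2⟩ := key _ _ _ hp
  obtain ⟨q', hq1, hq2⟩ := key _ _ _ hq'
  have hmod : (a' + p') + (q' + b') ≡ t [MOD critCyclicity A] := by
    refine ((ha1.add hp1).add (hq1.add hb1)).trans ?_
    obtain ⟨g, hg⟩ : ∃ g, critCyclicity A = g + 1 := ⟨_, (Nat.sub_add_cancel hγ).symm⟩
    rw [hg, Nat.add_sub_cancel, ← hab,
      show a + p + (q + (p + q) * g + b) = a + b + (g + 1) * (p + q) by ring]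
    simp [Nat.ModEq]
  refine le_trans ?_ (ht c hc _ _ hmod i j)
  exact mul_le_mul' ((mul_le_mul' ha2 hp2).trans (mpow_mul_mpow_le _ _ _ _ _ _))
    ((mul_le_mul' hq2 hb2).trans (mpow_mul_mpow_le _ _ _ _ _ _))

/-- Long walks that meet the component of a critical node are dominated by the CSR term. -/
theorem eventually_mpow_mul_mpow_le_csr (A : Mat n) :
    ∀ᶠ t in atTop, ∀ c, CritNode A c → ∀ x, SameComp (Edge A) x c → ∀ a b, a + b = t → ∀ i j,
      mpow A a i x * mpow A b x j ≤ mcgm A ^ t * csr A t i j := by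
  by_cases h0 : mcgm A = 0
  · exact Eventually.of_forall fun _ c hc => absurd h0 hc.mcgm_ne_zero
  have hpos : 0 < mcgm A := pos_iff_ne_zero.2 h0
  have hdiag : ∀ d, 0 < d → ∀ x,
      mpow (restrict (normalized A) {x | ¬CritNode A x}) d x x < 1 := by
    intro d hd x
    by_contra! h
    have hx : x ∈ {x | ¬CritNode A x} :=
      (mem_of_mpow_restrict_ne_zero hd (ne_of_gt (zero_lt_one.trans_le h))).1
    have h1 := h.trans (mpow_restrict_le _ _ _ _ _)
    rw [mpow_normalized, one_le_div (pow_pos hpos d)] at h1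
    exact hx (critNode_of_le h0 hd h1)
  obtain ⟨δ, hδ, hcsr⟩ := exists_pos_le_csr A
  filter_upwards [hcsr, eventually_mpow_le hdiag hδ, eventually_le_csr A]
    with t h1 h2 h3 c hc x hx a b hab i j
  by_cases ha : mpow A a i x = 0
  · rw [ha, zero_mul]; exact zero_le
  by_cases hb : mpow A b x j = 0
  · rw [hb, mul_zero]; exact zero_le
  have hmain : mpow (normalized A) t i j ≤ csr A t i j := by
    rcases mpow_le_restrict_or (normalized A) {x | ¬CritNode A x} t i j with h | h
    · exact h.trans ((h2 i j).trans (h1 c hc x hx a b hab i j ha hb))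
    · obtain ⟨d, hd, a', b', hab', h⟩ := h
      have hd : CritNode A d := by simpa using hd
      exact h.trans (h3 d hd a' b' (by rw [hab']) i j)
  rw [mpow_normalized, div_le_iff₀ (pow_pos hpos t), mul_comm] at hmain
  refine le_trans ?_ hmain
  rw [← hab]
  exact mpow_mul_mpow_le _ _ _ _ _ _

theorem eventually_mcgm_pow_mul_csr_le (A : Mat n) (h0 : mcgm A ≠ 0) :
    ∀ᶠ t in atTop, ∀ i j, mcgm A ^ t * csr A t i j ≤ mpow A t i j := by
  filter_upwards [eventually_csr_le A] with t ht i j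
  have := ht i j
  rwa [mpow_normalized, le_div_iff₀ (pow_pos (pos_iff_ne_zero.2 h0) t), mul_comm] at this

/-! ### Reductions -/

theorem restrict_mono (A : Mat n) {K K' : Set (Fin n)} (h : K ⊆ K') (i j : Fin n) :
    restrict A K i j ≤ restrict A K' i j := by
  unfold restrict
  by_cases hK : i ∈ K ∧ j ∈ K
  · rw [if_pos hK, if_pos ⟨h hK.1, h hK.2⟩]
  · rw [if_neg hK]; exact zero_le

theorem restrict_univ (A : Mat n) : restrict A Set.univ = A :=
  Matrix.ext fun i j => by simp [restrict]

theorem restrict_restrict (A : Mat n) {K K' : Set (Fin n)} (h : K' ⊆ K) :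
    restrict (restrict A K) K' = restrict A K' :=
  Matrix.ext fun i j => by
    by_cases hK : i ∈ K' ∧ j ∈ K'
    · simp [restrict, hK.1, hK.2, h hK.1, h hK.2]
    · simp [restrict, hK]

theorem CritNode.mem_of_restrict {A : Mat n} {K : Set (Fin n)} {x : Fin n}
    (h : CritNode (restrict A K) x) : x ∈ K := by
  obtain ⟨k, hk, hx⟩ := h.exists_le
  exact (mem_of_mpow_restrict_ne_zero hk
    (ne_of_gt ((pow_pos (pos_iff_ne_zero.2 h.mcgm_ne_zero) k).trans_le hx))).1

theorem mcgm_restrict_lt {A : Mat n} {K K' : Set (Fin n)} (h : K' ⊆ K)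
    (hc : ∀ x, CritNode (restrict A K) x → x ∉ K') (h0 : mcgm (restrict A K) ≠ 0) :
    mcgm (restrict A K') < mcgm (restrict A K) := by
  refine lt_of_le_of_ne (mcgm_mono (restrict_mono A h)) fun he => ?_
  obtain ⟨x, hx⟩ := exists_critNode (he ▸ h0 : mcgm (restrict A K') ≠ 0)
  obtain ⟨k, hk, hle⟩ := hx.exists_le
  rw [he] at hle
  exact hc x (critNode_of_le h0 hk (hle.trans (mpow_mono (restrict_mono A h) k x x)))
    hx.mem_of_restrict

/-- A sequence of node sets of which each step removes at least the critical nodes of the current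
submatrix. -/
def IsReduction (A : Mat n) (K : ℕ → Set (Fin n)) : Prop :=
  ∀ k, K (k + 1) ⊆ K k ∧ ∀ x, CritNode (restrict A (K k)) x → x ∉ K (k + 1)

theorem isReduction_nachtK (A : Mat n) : IsReduction A (nachtK A) :=
  fun _ => ⟨Set.sdiff_subset, fun _ hx h => h.2 hx⟩

theorem isReduction_ultK (A : Mat n) : IsReduction A (ultK A) :=
  fun _ => ⟨Set.sdiff_subset, fun x hx h => h.2 ⟨x, hx, SameComp.rfl⟩⟩

namespace IsReduction

variable {A : Mat n} {K : ℕ → Set (Fin n)}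

theorem antitone (h : IsReduction A K) : Antitone K :=
  antitone_nat_of_succ_le fun k => (h k).1

theorem mcgm_antitone (h : IsReduction A K) : Antitone fun k => mcgm (restrict A (K k)) :=
  fun _ _ hkl => mcgm_mono (restrict_mono A (h.antitone hkl))

theorem mcgm_lt (h : IsReduction A K) {k l : ℕ} (hkl : k < l)
    (h0 : mcgm (restrict A (K k)) ≠ 0) :
    mcgm (restrict A (K l)) < mcgm (restrict A (K k)) :=
  (h.mcgm_antitone (Nat.succ_le_of_lt hkl)).trans_lt (mcgm_restrict_lt (h k).1 (h k).2 h0)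

theorem lt_of_mcgm_ne_zero (h : IsReduction A K) {k : ℕ} (h0 : mcgm (restrict A (K k)) ≠ 0) :
    k < n := by
  have key : ∀ k, mcgm (restrict A (K k)) ≠ 0 → (K (k + 1)).ncard + k + 1 ≤ n := by
    intro k
    induction k with
    | zero =>
      intro h0
      obtain ⟨x, hx⟩ := exists_critNode h0
      have h1 : (K (0 + 1)).ncard < (K 0).ncard :=
        Set.ncard_lt_ncard (LE.le.ssubset_of_mem_notMem (h 0).1
          hx.mem_of_restrict ((h 0).2 x hx))
      have h2 := Set.ncard_le_card (K 0)
      simp only [Nat.card_eq_fintype_card, Fintype.card_fin] at h2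
      omega
    | succ k ih =>
      intro h0
      have h1 := ih (ne_of_gt ((pos_iff_ne_zero.2 h0).trans_le (h.mcgm_antitone k.le_succ)))
      obtain ⟨x, hx⟩ := exists_critNode h0
      have h2 : (K (k + 1 + 1)).ncard < (K (k + 1)).ncard :=
        Set.ncard_lt_ncard (LE.le.ssubset_of_mem_notMem (h (k + 1)).1
          hx.mem_of_restrict ((h (k + 1)).2 x hx))
      omega
  have := key k h0
  omega

end IsReduction

/-! ### The ultimate reduction inside the canonical Nachtigall reduction -/

theorem reflTransGen_of_mpow_ne_zero {A : Mat n} {t : ℕ} {i j : Fin n} (h : mpow A t i j ≠ 0) :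
    Relation.ReflTransGen (Edge A) i j := by
  obtain ⟨p, rfl, rfl, hp⟩ := exists_path_of_mpow_ne_zero h
  rw [hp, Finset.prod_ne_zero_iff] at h
  exact reflTransGen_of_walk (fun s hs => h s (Finset.mem_range.2 hs)) (Nat.zero_le t) le_rfl

/-- Closed walks stay inside their strongly connected component. -/
theorem mpow_diag_le_restrict {A : Mat n} {K : Set (Fin n)} {x : Fin n}
    (h : ∀ y, SameComp (Edge A) x y → y ∈ K) (t : ℕ) :
    mpow A t x x ≤ mpow (restrict A K) t x x := by
  by_cases h0 : mpow A t x x = 0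
  · rw [h0]; exact zero_le
  rcases mpow_le_restrict_or A K t x x with h1 | ⟨y, hy, a, b, -, h1⟩
  · exact h1
  · have h2 := ne_of_gt ((pos_iff_ne_zero.2 h0).trans_le h1)
    exact absurd (h y ⟨reflTransGen_of_mpow_ne_zero (left_ne_zero_of_mul h2),
      reflTransGen_of_mpow_ne_zero (right_ne_zero_of_mul h2)⟩) hy

theorem ultK_of_sameComp {A : Mat n} {k : ℕ} {x y : Fin n} (hx : x ∈ ultK A k)
    (h : SameComp (Edge A) x y) : y ∈ ultK A k := by
  induction k with
  | zero => exact Set.mem_univ y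
  | succ k ih => exact ⟨ih hx.1, fun ⟨c, hc, hyc⟩ => hx.2 ⟨c, hc, h.trans hyc⟩⟩

theorem reflTransGen_restrict_ultK {A : Mat n} {k : ℕ} {x y : Fin n} (hx : x ∈ ultK A k)
    (h : Relation.ReflTransGen (Edge A) x y) (h' : Relation.ReflTransGen (Edge A) y x) :
    Relation.ReflTransGen (Edge (restrict A (ultK A k))) x y := by
  induction h with
  | refl => exact .refl
  | @tail y z hxy hyz ih =>
    have hyx := (Relation.ReflTransGen.single hyz).trans h'
    refine (ih hyx).tail ?_
    have hy : y ∈ ultK A k := ultK_of_sameComp hx ⟨hxy, hyx⟩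
    have hz : z ∈ ultK A k := ultK_of_sameComp hx ⟨hxy.tail hyz, h'⟩
    change restrict A (ultK A k) y z ≠ 0
    rw [restrict, if_pos ⟨hy, hz⟩]
    exact hyz

/-- A component `M` of maximal mean `ultLam A k` first loses a node in the Nachtigall reduction at
a step whose critical digraph has a cycle inside `M`. -/
theorem exists_nachtLam_eq_ultLam {A : Mat n} {k : ℕ} (h0 : ultLam A k ≠ 0) :
    ∃ μ, nachtLam A μ = ultLam A k := by
  classical
  obtain ⟨c, hc⟩ := exists_critNode h0
  have hcK := hc.mem_of_restrict
  have hge : ∀ μ, {y | SameComp (Edge A) c y} ⊆ nachtK A μ → ultLam A k ≤ nachtLam A μ := by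
    intro μ h
    obtain ⟨d, hd, hle⟩ := hc.exists_le
    refine (pow_le_pow_iff_left₀ zero_le zero_le hd.ne').1 (hle.trans ?_)
    exact (mpow_restrict_le A _ d c c).trans
      ((mpow_diag_le_restrict h d).trans (mpow_diag_le_mcgm _ d c))
  have hex : ∃ μ, ¬{y | SameComp (Edge A) c y} ⊆ nachtK A μ := by
    by_contra! h
    have h1 : nachtLam A n ≠ 0 := ne_of_gt ((pos_iff_ne_zero.2 h0).trans_le (hge n (h n)))
    exact lt_irrefl n ((isReduction_nachtK A).lt_of_mcgm_ne_zero h1)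
  have hspec := Nat.find_spec hex
  obtain ⟨m, hm⟩ : ∃ m, Nat.find hex = m + 1 := Nat.exists_eq_succ_of_ne_zero fun h => by
    rw [h] at hspec
    exact hspec (Set.subset_univ _)
  have hsub : {y | SameComp (Edge A) c y} ⊆ nachtK A m :=
    not_not.1 (Nat.find_min hex (m := m) (by omega))
  rw [hm] at hspec
  obtain ⟨y, hy, hyK⟩ := Set.not_subset.1 hspec
  have hcrit : CritNode (restrict A (nachtK A m)) y := by
    by_contra h
    exact hyK ⟨hsub hy, h⟩
  refine ⟨m, le_antisymm ?_ (hge m hsub)⟩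
  obtain ⟨d, hd, hle⟩ := hcrit.exists_le
  refine (pow_le_pow_iff_left₀ zero_le zero_le hd.ne').1 (hle.trans ?_)
  exact (mpow_restrict_le A _ d y y).trans ((mpow_diag_le_restrict
    (fun z hz => ultK_of_sameComp hcK (SameComp.trans hy hz)) d).trans (mpow_diag_le_mcgm _ d y))

theorem ultLam_renum {A : Mat n} {ν : ℕ} (h : ν ∈ sigmaSet A) :
    ultLam A (renum A ν) = nachtLam A ν := by
  classical
  exact Nat.sInf_mem (s := {k | ultLam A k = nachtLam A ν}) (Finset.mem_filter.1 h).2.2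

theorem nachtLam_ne_zero {A : Mat n} {ν : ℕ} (h : ν ∈ sigmaSet A) : nachtLam A ν ≠ 0 := by
  classical
  exact (Finset.mem_filter.1 h).2.1

theorem exists_renum_eq {A : Mat n} {k : ℕ} (h0 : ultLam A k ≠ 0) :
    ∃ ν ∈ sigmaSet A, renum A ν = k := by
  classical
  obtain ⟨ν, hν⟩ := exists_nachtLam_eq_ultLam h0
  have h1 : nachtLam A ν ≠ 0 := hν ▸ h0
  have hmem : ν ∈ sigmaSet A := Finset.mem_filter.2
    ⟨Finset.mem_range.2 ((isReduction_nachtK A).lt_of_mcgm_ne_zero h1), h1, k, hν.symm⟩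
  refine ⟨ν, hmem, ?_⟩
  have h2 : ultLam A (renum A ν) = ultLam A k := (ultLam_renum hmem).trans hν
  rcases lt_trichotomy (renum A ν) k with h | h | h
  · exact absurd ((isReduction_ultK A).mcgm_lt h (h2 ▸ h0 : ultLam A _ ≠ 0)) h2.le.not_gt
  · exact h
  · exact absurd ((isReduction_ultK A).mcgm_lt h h0) h2.ge.not_gt

theorem renum_le_renum_iff {A : Mat n} {μ ν : ℕ} (hμ : μ ∈ sigmaSet A) (hν : ν ∈ sigmaSet A) :
    renum A μ ≤ renum A ν ↔ μ ≤ ν := by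
  have h : renum A μ ≤ renum A ν ↔ nachtLam A ν ≤ nachtLam A μ := by
    rw [← ultLam_renum hμ, ← ultLam_renum hν]
    refine ⟨fun h => (isReduction_ultK A).mcgm_antitone h, fun h => ?_⟩
    by_contra! hlt
    exact h.not_gt ((isReduction_ultK A).mcgm_lt hlt
      (by rw [← ultLam, ultLam_renum hν]; exact nachtLam_ne_zero hν))
  rw [h]
  refine ⟨fun h => ?_, fun h => (isReduction_nachtK A).mcgm_antitone h⟩
  by_contra! hlt
  exact h.not_gt ((isReduction_nachtK A).mcgm_lt hlt (nachtLam_ne_zero hν))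

/-! ### The expansion -/

theorem mpow_eq_zero_of_mcgm_eq_zero {A : Mat n} (h0 : mcgm A = 0) {t : ℕ} (ht : n ≤ t)
    (i j : Fin n) : mpow A t i j = 0 := by
  obtain ⟨d, hd, -, h⟩ := mpow_le_of_cycle_le (fun d _ _ x => mpow_diag_le_mcgm A d x) ht i j
  rw [h0, zero_pow (by omega), zero_mul] at h
  exact le_zero_iff.1 h

theorem mcgm_ultMat {A : Mat n} {ν : ℕ} (h : ν ∈ sigmaSet A) :
    mcgm (ultMat A ν) = nachtLam A ν := ultLam_renum h

/-- Walks in `A[K°ₖ]` either stay in the next node set or meet a component with a critical node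
of `A[K°ₖ]`; walks of the second kind are dominated by the CSR term of that step. -/
theorem eventually_mpow_restrict_ultK_le (A : Mat n) (k : ℕ) :
    ∀ᶠ t in atTop, ∀ i j, mpow (restrict A (ultK A k)) t i j ≤
      ((sigmaSet A).filter fun ν => k ≤ renum A ν).sup fun ν =>
        nachtLam A ν ^ t * csr (ultMat A ν) t i j := by
  obtain ⟨m, hm⟩ : ∃ m, n ≤ k + m := ⟨n, by omega⟩
  induction m generalizing k with
  | zero =>
    have h0 : mcgm (restrict A (ultK A k)) = 0 := by
      by_contra h
      have := (isReduction_ultK A).lt_of_mcgm_ne_zero h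
      omega
    filter_upwards [eventually_ge_atTop n] with t ht i j
    rw [mpow_eq_zero_of_mcgm_eq_zero h0 ht]
    exact zero_le
  | succ m ih =>
    by_cases h0 : mcgm (restrict A (ultK A k)) = 0
    · filter_upwards [eventually_ge_atTop n] with t ht i j
      rw [mpow_eq_zero_of_mcgm_eq_zero h0 ht]
      exact zero_le
    obtain ⟨ν, hν, rfl⟩ := exists_renum_eq h0
    filter_upwards [ih (renum A ν + 1) (by omega), eventually_ge_atTop 1,
      eventually_mpow_mul_mpow_le_csr (ultMat A ν)] with t h1 ht h2 i j
    by_cases hz : mpow (restrict A (ultK A (renum A ν))) t i j = 0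
    · rw [hz]; exact zero_le
    rcases mpow_le_restrict_or (restrict A (ultK A (renum A ν))) (ultK A (renum A ν + 1)) t i j
      with h | ⟨x, hx, a, b, hab, h⟩
    · rw [restrict_restrict A ((isReduction_ultK A) _).1] at h
      refine (h.trans (h1 i j)).trans (Finset.sup_mono fun l hl => ?_)
      rw [Finset.mem_filter] at hl ⊢
      exact ⟨hl.1, by omega⟩
    · have hne := ne_of_gt ((pos_iff_ne_zero.2 hz).trans_le h)
      have hxK : x ∈ ultK A (renum A ν) := by
        rcases Nat.eq_zero_or_pos a with rfl | ha
        · exact (mem_of_mpow_restrict_ne_zero (by omega) (right_ne_zero_of_mul hne)).1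
        · exact (mem_of_mpow_restrict_ne_zero ha (left_ne_zero_of_mul hne)).2
      obtain ⟨c, hc, hxc⟩ : ∃ c, CritNode (ultMat A ν) c ∧ SameComp (Edge A) x c := by
        by_contra h'
        exact hx ⟨hxK, h'⟩
      have hxc' : SameComp (Edge (ultMat A ν)) x c :=
        ⟨reflTransGen_restrict_ultK hxK hxc.1 hxc.2,
          reflTransGen_restrict_ultK (ultK_of_sameComp hxK hxc) hxc.2 hxc.1⟩
      have h3 := h2 c hc x hxc' a b hab i j
      rw [mcgm_ultMat hν] at h3
      exact (h.trans h3).trans (Finset.le_sup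
        (f := fun ν => nachtLam A ν ^ t * csr (ultMat A ν) t i j)
        (Finset.mem_filter.2 ⟨hν, le_rfl⟩))

theorem eventually_mpow_restrict_ultK_eq (A : Mat n) (k : ℕ) :
    ∀ᶠ t in atTop, ∀ i j, mpow (restrict A (ultK A k)) t i j =
      ((sigmaSet A).filter fun ν => k ≤ renum A ν).sup fun ν =>
        nachtLam A ν ^ t * csr (ultMat A ν) t i j := by
  have hge : ∀ᶠ t in atTop, ∀ ν ∈ sigmaSet A, ∀ i j,
      nachtLam A ν ^ t * csr (ultMat A ν) t i j ≤ mpow (ultMat A ν) t i j := by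
    refine (Filter.eventually_all_finset _).2 fun ν hν => ?_
    rw [← mcgm_ultMat hν]
    exact eventually_mcgm_pow_mul_csr_le _ (by rw [mcgm_ultMat hν]; exact nachtLam_ne_zero hν)
  filter_upwards [eventually_mpow_restrict_ultK_le A k, hge] with t h1 h2 i j
  refine le_antisymm (h1 i j) (Finset.sup_le fun ν hν => ?_)
  obtain ⟨hν, hk⟩ := Finset.mem_filter.1 hν
  exact (h2 ν hν i j).trans (mpow_mono (restrict_mono A ((isReduction_ultK A).antitone hk)) t i j)

end MaxAlg

theorem theorem5p4 (n : ℕ) (A : MaxAlg.Mat n) :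
    (∀ ν ∈ MaxAlg.sigmaSet A, MaxAlg.KleeneFinite (MaxAlg.normPow (MaxAlg.ultMat A ν))) ∧
    (∀ μ ∈ MaxAlg.sigmaSet A, ∃ T : ℕ, ∀ t ≥ T, ∀ i j : Fin n,
      MaxAlg.mpow (MaxAlg.ultMat A μ) t i j =
        ((MaxAlg.sigmaSet A).filter fun ν => μ ≤ ν).sup fun ν =>
          MaxAlg.nachtLam A ν ^ t * MaxAlg.csr (MaxAlg.ultMat A ν) t i j) ∧
    (∃ T : ℕ, ∀ t ≥ T, ∀ i j : Fin n,
      MaxAlg.mpow A t i j =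
        (MaxAlg.sigmaSet A).sup fun ν =>
          MaxAlg.nachtLam A ν ^ t * MaxAlg.csr (MaxAlg.ultMat A ν) t i j) := by
  refine ⟨fun ν _ => MaxAlg.kleeneFinite_of_diag_le (MaxAlg.mpow_normPow_diag_le _),
    fun μ hμ => ?_, ?_⟩
  · obtain ⟨T, hT⟩ := Filter.eventually_atTop.1
      (MaxAlg.eventually_mpow_restrict_ultK_eq A (MaxAlg.renum A μ))
    refine ⟨T, fun t ht i j => ?_⟩
    rw [← Finset.filter_congr fun ν hν => MaxAlg.renum_le_renum_iff hμ hν]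
    exact hT t ht i j
  · obtain ⟨T, hT⟩ := Filter.eventually_atTop.1 (MaxAlg.eventually_mpow_restrict_ultK_eq A 0)
    refine ⟨T, fun t ht i j => ?_⟩
    have h := hT t ht i j
    rw [Finset.filter_true_of_mem fun ν _ => Nat.zero_le _] at h
    rw [← h]
    change _ = MaxAlg.mpow (MaxAlg.restrict A Set.univ) t i j
    rw [MaxAlg.restrict_univ]
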